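/- Let $k$ be a finite field with $q$ elements. Characters take values in a fixed algebraically closed field $K$ of characteristic $0$ (for instance $\overline{\mathbb Q}$). Characters $\eta$ of $k^\times$ (including the trivial one $\varepsilon$) are extended to $k$ by $\eta(0)=0$, and $\overline\eta=\eta^{-1}$. Fix a non-trivial additive character $\psi$ of $k$ and put $$g(\eta)=-\sum_{x\in k^\times}\psi(x)\eta(x),\quad g^\circ(\eta)=\begin{cases}q\,g(\eta)&(\eta=\varepsilon)\\ g(\eta)&(\eta\ne\varepsilon)\end{cases},\quad j(\eta_1,\eta_2)=-\sum_{x\in k}\eta_1(x)\eta_2(1-x),$$ $$(\alpha)_\nu=\frac{g(\alpha\nu)}{g(\alpha)},\qquad (\alpha)^\circ_\nu=\frac{g^\circ(\alpha\nu)}{g^\circ(\alpha)},$$ $$F_4(\alpha;\beta;\gamma_1,\gamma_2;z_1,z_2)=\frac1{(1-q)^2}\sum_{\nu_1,\nu_2\in\widehat{k^\times}}\frac{(\alpha)_{\nu_1\nu_2}(\beta)_{\nu_1\nu_2}}{(\gamma_1)^\circ_{\nu_1}(\gamma_2)^\circ_{\nu_2}(\varepsilon)^\circ_{\nu_1}(\varepsilon)^\circ_{\nu_2}}\,\nu_1(z_1)\nu_2(z_2).$$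 Let $d\ge 1$ divide $q-1$, let $\mu_d\subset k^\times$ be the group of $d$-th roots of unity, let $\varphi$ be a generator of $\widehat{k^\times}$, and put $\varphi_d=\varphi^{(q-1)/d}$ and $\chi=\varphi|_{\mu_d}$. Let $a,b,c_1,c_2$ be integers with $\gcd(d,a)=\gcd(d,b)=\gcd(d,c_i-a)=\gcd(d,c_i-b)=1$ for $i=1,2$, and let $\lambda_1,\lambda_2\in k\setminus\{0,1\}$. For $n\in\mathbb Z$ let $\langle n\rangle\in\{0,\dots,d-1\}$ be the representative of $n$ modulo $d$, and let $S_{4,\lambda}$ be the affine surface over $k$ $$y^d=x_1^{\langle a\rangle}x_2^{\langle b\rangle}(1-x_1)^{\langle c_1-a\rangle}(1-x_2)^{\langle c_2-b\rangle}(1-\lambda_1x_1)^{\langle a-c_1-c_2\rangle}(1-\lambda_2x_2)^{\langle b-c_1-c_2\rangle}(1-\lambda_1x_1-\lambda_2x_2)^{\langle c_1+c_2-a-b\rangle}$$ (a factor with exponent $0$ is the constant $1$), on which $\xi\in\mu_d$ acts by $(x_1,x_2,y)\mapsto(x_1,x_2,\xi y)$. With $F$ the $q$-Frobenius, let $$N_1(S_{4,\lambda};\chi^m)=\frac1d\sum_{\xi\in\mu_d}\chi^m(\xi)\,\#\{P\in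 S_{4,\lambda}(\overline k)\mid F(P)=\xi\cdot P\}\qquad(m\in\mathbb Z/d\mathbb Z).$$ Then $N_1(S_{4,\lambda};\chi^m)=q^2$ if $m=0$. If $m\neq0$ in $\mathbb Z/d\mathbb Z$ and $d$ divides none of $a-c_1-c_2$, $b-c_1-c_2$, $c_1+c_2-a-b$, then $$N_1(S_{4,\lambda};\chi^m)=J\cdot F_4\big(\alpha;\beta;\gamma_1,\gamma_2;\lambda_1(1-\lambda_2),\lambda_2(1-\lambda_1)\big)+S_0+S_1+S_2,$$ where $\alpha=\varphi_d^{ma}$, $\beta=\varphi_d^{mb}$, $\gamma_i=\varphi_d^{mc_i}$, $J=j(\alpha,\overline\alpha\gamma_1)\,j(\beta,\overline\beta\gamma_2)$ and $$\begin{aligned}S_0&=\alpha\beta(-1)\,j(\alpha\overline{\gamma_2},\beta\overline{\gamma_1})\,\overline{\gamma_1}(\lambda_1)\overline{\gamma_2}(\lambda_2),\\ S_1&=j(\overline{\alpha\beta}\gamma_1\gamma_2,\beta)\,\overline{\gamma_1}(\lambda_1)\,\overline\alpha\gamma_1(\lambda_1-1)\,\overline\beta(\lambda_2),\\ S_2&=j(\overline{\alpha\beta}\gamma_1\gamma_2,\alpha)\,\overline{\gamma_2}(\lambda_2)\,\overline\beta\gamma_2(\lambda_2-1)\,\overline\alpha(\lambda_1).\end{aligned}$$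 Moreover, if the representatives $\langle n\rangle$ are taken in $\{1,\dots,d\}$ instead (so that all seven factors occur in the equation), then both formulas hold without the condition that $d$ divides none of the three integers. -/

import Mathlib

noncomputable section

namespace AppellFF

/-! ### Gauss sums, Jacobi sums and Appell's function `F₄` over a finite field

`MulChar k K` is the group of characters of `kˣ`, extended by `η 0 = 0` (also for the trivial
character `1`). -/

section Hypergeometric

variable {k K : Type*} [Field k] [Fintype k] [Field K]

/-- The Gauss sum `g(η) = - ∑_{x ≠ 0} ψ(x) η(x)`. -/
def g (ψ : AddChar k K) (η : MulChar k K) : K := - gaussSum η ψ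

open Classical in
/-- `g°(η) = q ^ δ(η) g(η)`, where `δ(η)` is `1` if `η` is trivial and `0` otherwise. -/
def gCirc (ψ : AddChar k K) (η : MulChar k K) : K :=
  (Fintype.card k : K) ^ (if η = 1 then 1 else 0) * g ψ η

/-- The Jacobi sum `j(η₁, η₂) = - ∑_{x₁ + x₂ = 1} η₁(x₁) η₂(x₂)`. -/
def j (η₁ η₂ : MulChar k K) : K := - jacobiSum η₁ η₂

/-- The Pochhammer symbol `(α)_ν = g(αν) / g(α)`. -/
def poch (ψ : AddChar k K) (α ν : MulChar k K) : K := g ψ (α * ν) / g ψ α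

/-- The Pochhammer symbol `(α)_ν° = g°(αν) / g°(α)`. -/
def pochCirc (ψ : AddChar k K) (α ν : MulChar k K) : K := gCirc ψ (α * ν) / gCirc ψ α

/-- Appell's function `F₄(α; β; γ₁, γ₂; z₁, z₂)` over `k`; the sum is over the finite set of all
pairs of characters of `kˣ`. -/
def F4 (ψ : AddChar k K) (α β γ₁ γ₂ : MulChar k K) (z₁ z₂ : k) : K :=
  1 / (1 - (Fintype.card k : K)) ^ 2 *
    ∑ᶠ ν : MulChar k K × MulChar k K,
      poch ψ α (ν.1 * ν.2) * poch ψ β (ν.1 * ν.2) /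
        (pochCirc ψ γ₁ ν.1 * pochCirc ψ γ₂ ν.2 * pochCirc ψ 1 ν.1 * pochCirc ψ 1 ν.2) *
        (ν.1 z₁ * ν.2 z₂)

/-- `J = j(α, α⁻¹γ₁) j(β, β⁻¹γ₂)`. -/
def J (α β γ₁ γ₂ : MulChar k K) : K := j α (α⁻¹ * γ₁) * j β (β⁻¹ * γ₂)

def S0 (α β γ₁ γ₂ : MulChar k K) (x y : k) : K :=
  (α * β) (-1) * j (α * γ₂⁻¹) (β * γ₁⁻¹) * γ₁⁻¹ x * γ₂⁻¹ y

def S1 (α β γ₁ γ₂ : MulChar k K) (x y : k) : K :=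
  j ((α * β)⁻¹ * γ₁ * γ₂) β * γ₁⁻¹ x * (α⁻¹ * γ₁) (x - 1) * β⁻¹ y

def S2 (α β γ₁ γ₂ : MulChar k K) (x y : k) : K :=
  j ((α * β)⁻¹ * γ₁ * γ₂) α * γ₂⁻¹ y * (β⁻¹ * γ₂) (y - 1) * α⁻¹ x

end Hypergeometric

/-! ### Twisted point counts -/

/-- `N_r(V; χ) = (1 / #G) ∑_{g ∈ G} χ(g) #{x ∈ V(k̄) | F^r(x) = g x}` for a finite abelian
group `G` acting on the set `X = V(k̄)` of geometric points with `q`-Frobenius `F`. -/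
def N (X : Type*) {G K : Type*} [CommGroup G] [MulAction G X] [Field K] (F : X → X) (χ : G →* Kˣ)
    (r : ℕ) : K :=
  1 / (Nat.card G : K) * ∑ᶠ g : G, (χ g : K) * (Nat.card {x : X // F^[r] x = g • x} : K)

/-- The geometric points `(x₁, x₂, y)` of the affine surface `y ^ d = f(x₁, x₂)` over `k`. -/
@[ext]
structure CyclicSurface {k : Type*} [Field k] (d : ℕ) (f : MvPolynomial (Fin 2) k) where
  x : Fin 2 → AlgebraicClosure k
  y : AlgebraicClosure k
  eqn : y ^ d = MvPolynomial.aeval x f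

namespace CyclicSurface

variable {k : Type*} [Field k] {d : ℕ} {f : MvPolynomial (Fin 2) k}

/-- The action `ξ • (x₁, x₂, y) = (x₁, x₂, ξ y)` of the group `μ_d ⊆ kˣ`. -/
instance : MulAction (rootsOfUnity d k) (CyclicSurface d f) where
  smul ξ P :=
    { x := P.x
      y := algebraMap k (AlgebraicClosure k) ((ξ : kˣ) : k) * P.y
      eqn := by
        have h : (((ξ : kˣ) : k)) ^ d = 1 := by
          have := (mem_rootsOfUnity d (ξ : kˣ)).1 ξ.2
          rw [← Units.val_pow_eq_pow_val, this, Units.val_one]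
        rw [mul_pow, ← map_pow, h, map_one, one_mul, P.eqn] }
  one_smul P := by
    refine CyclicSurface.ext rfl ?_
    change algebraMap k (AlgebraicClosure k) (1 : k) * P.y = P.y
    simp
  mul_smul ξ ζ P := by
    refine CyclicSurface.ext rfl ?_
    change algebraMap k (AlgebraicClosure k) (((ξ : kˣ) : k) * ((ζ : kˣ) : k)) * P.y =
      algebraMap k (AlgebraicClosure k) ((ξ : kˣ) : k) *
        (algebraMap k (AlgebraicClosure k) ((ζ : kˣ) : k) * P.y)
    rw [map_mul, mul_assoc]

/-- The `q`-Frobenius `(x₁, x₂, y) ↦ (x₁ ^ q, x₂ ^ q, y ^ q)`, `q = #k`. -/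
def frob [Fintype k] (P : CyclicSurface d f) : CyclicSurface d f where
  x i := P.x i ^ Fintype.card k
  y := P.y ^ Fintype.card k
  eqn := by
    have h := congrArg (FiniteField.frobeniusAlgHom k (AlgebraicClosure k)) P.eqn
    rw [map_pow] at h
    rw [MvPolynomial.comp_aeval_apply] at h
    simpa [FiniteField.frobeniusAlgHom_apply] using h

end CyclicSurface

/-- The representative of `n` modulo `d` in `{0, …, d - 1}`. -/
def res (d : ℕ) (n : ℤ) : ℕ := (n % (d : ℤ)).toNat

/-- The representative of `n` modulo `d` in `{1, …, d}`. -/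
def posRes (d : ℕ) (n : ℤ) : ℕ := if (d : ℤ) ∣ n then d else res d n

open MvPolynomial in
/-- The product of powers of linear forms on the right-hand side of the equation `y ^ d = …` of
the surface attached to `F₄`; `e n` is the exponent chosen for the integer `n`. -/
def poly4 {k : Type*} [Field k] (e : ℤ → ℕ) (a b c₁ c₂ : ℤ) (l₁ l₂ : k) :
    MvPolynomial (Fin 2) k :=
  X 0 ^ e a * X 1 ^ e b * (1 - X 0) ^ e (c₁ - a) * (1 - X 1) ^ e (c₂ - b) *
    (1 - C l₁ * X 0) ^ e (a - c₁ - c₂) * (1 - C l₂ * X 1) ^ e (b - c₁ - c₂) *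
    (1 - C l₁ * X 0 - C l₂ * X 1) ^ e (c₁ + c₂ - a - b)

/-- The surface `S_{4,λ}` (its geometric points), with exponents in `{0, …, d - 1}`. -/
abbrev Surface4 {k : Type*} [Field k] (d : ℕ) (a b c₁ c₂ : ℤ) (l₁ l₂ : k) : Type _ :=
  CyclicSurface d (poly4 (res d) a b c₁ c₂ l₁ l₂)

/-- The variant of the surface `S_{4,λ}` with exponents in `{1, …, d}`. It differs from
`Surface4` (for `d > 1` and `a`, `b`, `c₁ - a`, `c₂ - b` prime to `d`) only if `d` divides one of
`a - c₁ - c₂`, `b - c₁ - c₂`, `c₁ + c₂ - a - b`; then `Surface4` lacks a linear factor. -/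
abbrev Surface4Pos {k : Type*} [Field k] (d : ℕ) (a b c₁ c₂ : ℤ) (l₁ l₂ : k) : Type _ :=
  CyclicSurface d (poly4 (posRes d) a b c₁ c₂ l₁ l₂)

/-- The restriction `χ = φ|_{μ_d}`. -/
def chi {k K : Type*} [Field k] [Field K] (d : ℕ) (φ : MulChar k K) : rootsOfUnity d k →* Kˣ :=
  φ.toUnitHom.comp (rootsOfUnity d k).subtype

/-- `φ_d = φ ^ ((q - 1) / d)`. -/
def phiD {k K : Type*} [Field k] [Fintype k] [Field K] (d : ℕ) (φ : MulChar k K) : MulChar k K :=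
  φ ^ ((Fintype.card k - 1) / d)

/-- `J · F₄(α; β; γ₁, γ₂; x(1 - y), y(1 - x)) + S₀(x, y) + S₁(x, y) + S₂(x, y)`. -/
def rhs4 {k K : Type*} [Field k] [Fintype k] [Field K] (ψ : AddChar k K)
    (α β γ₁ γ₂ : MulChar k K) (x y : k) : K :=
  J α β γ₁ γ₂ * F4 ψ α β γ₁ γ₂ (x * (1 - y)) (y * (1 - x)) +
    (S0 α β γ₁ γ₂ x y + S1 α β γ₁ γ₂ x y + S2 α β γ₁ γ₂ x y)

end AppellFF

end

/-!
The surface is a cyclic cover of the affine plane. Over a rational point `(x₁, x₂)` where its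
equation takes the value `c ≠ 0`, Frobenius acts on the fibre `y ^ d = c` as the power residue
symbol of `c`, so the `χ ^ m`-part of the point count is a character sum over the plane.

On the hypergeometric side, the Gauss sums of the numerator of `F₄` are opened up and the sum over
each `νᵢ` is a Mellin inversion producing a Kloosterman sum. A monomial substitution then makes the
additive characters linear in two of the variables, and summing over these leaves `J · F₄` as a
character sum over a second plane, with coordinates `w` and `n`.

The two sums are matched by the birational map with `w = u / (1 - y v)` and with `n` the image of
`v` under a Möbius transformation depending on `w`. Each of the three lines where this map fails to
be a bijection contributes a Jacobi sum: these are `S₀`, `S₁` and `S₂`.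
-/

namespace AppellFF

open Finset

section FiniteSums

lemma sum_mul_sum_mul_sum_comm {R ι κ μ ν : Type*} [CommSemiring R] [Fintype ι] [Fintype κ]
    [Fintype μ] [Fintype ν] (A : ι → κ → R) (B : ι → κ → μ → R) (C : ι → κ → ν → R) :
    ∑ s, ∑ t, A s t * (∑ u, B s t u) * ∑ v, C s t v =
      ∑ u, ∑ s, ∑ v, ∑ t, A s t * B s t u * C s t v := by
  simp_rw [mul_assoc, sum_mul_sum, mul_sum]
  rw [sum_comm (γ := μ)]
  refine sum_congr rfl fun s _ => ?_
  rw [sum_comm]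
  exact sum_congr rfl fun u _ => sum_comm

variable {k : Type*} [Field k] [Fintype k]

lemma sum_comp_mul_left {M : Type*} [AddCommMonoid M] {c : k} (hc : c ≠ 0) (f : k → M) :
    ∑ x, f (c * x) = ∑ x, f x :=
  Equiv.sum_comp (Equiv.mulLeft₀ c hc) f

lemma sum_eq_sum_sub_of_mobius {M : Type*} [AddCommGroup M] {a b c e : k} (hc : c ≠ 0)
    (hdet : a * e - b * c ≠ 0) {f F : k → M} (hpole : ∀ v, c * v + e = 0 → F v = 0)
    (hF : ∀ v, c * v + e ≠ 0 → F v = f ((a * v + b) / (c * v + e))) :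
    ∑ v, F v = ∑ n, f n - f (a / c) := by
  classical
  -- As `0⁻¹ = 0`, this permutation is the Möbius transformation with its pole sent to `a / c`.
  let σ : k ≃ k := (Equiv.mulLeft₀ c hc).trans <| (Equiv.addRight e).trans <|
    (Equiv.inv k).trans <| (Equiv.mulLeft₀ _ (div_ne_zero hdet hc)).trans (Equiv.subLeft (a / c))
  have hσ (v : k) : σ v = a / c - (a * e - b * c) / c * (c * v + e)⁻¹ := rfl
  have summand (v : k) : F v = f (σ v) - if v = -e / c then f (a / c) else 0 := by
    have pole_iff : v = -e / c ↔ c * v + e = 0 := by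
      rw [eq_div_iff hc, mul_comm, eq_neg_iff_add_eq_zero]
    rcases eq_or_ne (c * v + e) 0 with hv | hv
    · rw [hpole v hv, if_pos (pole_iff.2 hv), hσ, hv, inv_zero, mul_zero, sub_zero, sub_self]
    · rw [hF v hv, if_neg (pole_iff.not.2 hv), sub_zero, hσ]
      congr 1
      rw [← div_eq_mul_inv, div_div, div_sub_div _ _ hc (mul_ne_zero hc hv),
        div_eq_div_iff hv (mul_ne_zero hc (mul_ne_zero hc hv))]
      ring
  rw [sum_congr rfl fun v _ => summand v, sum_sub_distrib, Equiv.sum_comp σ f,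
    Fintype.sum_ite_eq']

end FiniteSums

section MulChar

variable {k K : Type*} [Field k] [Field K]

lemma mulChar_apply_ne_zero (χ : MulChar k K) {x : k} (hx : x ≠ 0) : χ x ≠ 0 :=
  ((isUnit_iff_ne_zero.2 hx).map χ).ne_zero

lemma mulChar_apply_inv (χ : MulChar k K) (x : k) : χ x⁻¹ = (χ x)⁻¹ := by
  rw [← MulChar.inv_apply', MulChar.inv_apply_eq_inv']

lemma mulChar_apply_div (χ : MulChar k K) (x y : k) : χ (x / y) = χ x / χ y := by
  rw [div_eq_mul_inv, map_mul, mulChar_apply_inv, div_eq_mul_inv]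

lemma mulChar_apply_neg (χ : MulChar k K) (x : k) : χ (-x) = χ (-1) * χ x := by
  rw [← map_mul, neg_one_mul]

lemma mulChar_apply_neg_one_mul_self (χ : MulChar k K) : χ (-1) * χ (-1) = 1 := by
  rw [← map_mul, neg_mul_neg, one_mul, map_one]

lemma mulChar_inv_apply_neg_one (χ : MulChar k K) : χ⁻¹ (-1) = χ (-1) := by
  rw [MulChar.inv_apply', inv_neg, inv_one]

lemma sum_mulChar_apply_eq_zero [Finite k] [HasEnoughRootsOfUnity K (Monoid.exponent kˣ)]
    [Fintype (MulChar k K)] {c : k} (hc : c ≠ 1) : ∑ ν : MulChar k K, ν c = 0 := by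
  obtain ⟨χ, hχ⟩ := MulChar.exists_apply_ne_one_of_hasEnoughRootsOfUnity k K hc
  refine eq_zero_of_mul_eq_self_left hχ ?_
  simp_rw [mul_sum, ← MulChar.mul_apply]
  exact Equiv.sum_comp (Equiv.mulLeft χ) (fun ν : MulChar k K => ν c)

variable [Fintype k]

lemma jacobiSum_eq_apply_neg_one_mul_jacobiSum (χ η : MulChar k K) :
    jacobiSum χ η = χ (-1) * jacobiSum χ (χ * η)⁻¹ := by
  rw [jacobiSum, jacobiSum, mul_sum,
    sum_eq_sum_sub_of_mobius (a := 1) (b := 0) (c := 1) (e := -1)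
      (f := fun n => χ (-1) * (χ n * (χ * η)⁻¹ (1 - n))) one_ne_zero (by simp)]
  · simp [MulChar.map_zero]
  · intro x hx
    obtain rfl : x = 1 := by linear_combination hx
    simp [MulChar.map_zero]
  · intro x hx
    have hx' : x - 1 ≠ 0 := by simpa only [one_mul, ← sub_eq_add_neg] using hx
    have hχ := mulChar_apply_ne_zero χ hx'
    have e : 1 - x / (x - 1) = (-(x - 1))⁻¹ := by
      field_simp
      ring
    simp only [one_mul, add_zero, ← sub_eq_add_neg, e, mulChar_apply_inv, mulChar_apply_div,
      MulChar.inv_apply_eq_inv', MulChar.mul_apply, mulChar_apply_neg _ (x - 1)]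
    rw [← neg_sub x 1, mulChar_apply_neg η]
    field_simp
    linear_combination (-(χ x * η (-1) * η (x - 1))) * mulChar_apply_neg_one_mul_self χ

lemma sum_mulChar_mul_mulChar_sub (χ η : MulChar k K) {c : k} (hc : c ≠ 0) :
    ∑ x, χ x * η (c - x) = (χ * η) c * jacobiSum χ η := by
  rw [← sum_comp_mul_left hc, jacobiSum, mul_sum]
  refine sum_congr rfl fun x _ => ?_
  rw [show c - c * x = c * (1 - x) by ring, map_mul, map_mul, MulChar.mul_apply]
  ring

variable [HasEnoughRootsOfUnity K (Monoid.exponent kˣ)]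

lemma sum_mulChar_apply_one [Fintype (MulChar k K)] :
    ∑ ν : MulChar k K, ν (1 : k) = (Fintype.card k : K) - 1 := by
  have h := MulChar.card_eq_card_units_of_hasEnoughRootsOfUnity k K
  rw [Nat.card_eq_fintype_card, Nat.card_units, Nat.card_eq_fintype_card] at h
  simp only [map_one, sum_const, card_univ, nsmul_eq_mul, mul_one, h,
    Nat.cast_sub Fintype.card_pos, Nat.cast_one]

variable (k K) in
lemma natCast_card_sub_one_ne_zero : ((Fintype.card k - 1 : ℕ) : K) ≠ 0 := by
  obtain ⟨ζ, hζ⟩ := HasEnoughRootsOfUnity.exists_primitiveRoot K (Monoid.exponent kˣ)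
  rw [IsCyclic.exponent_eq_card, Nat.card_units, Nat.card_eq_fintype_card] at hζ
  have : NeZero (Fintype.card k - 1) := ⟨(Nat.sub_pos_of_lt Fintype.one_lt_card).ne'⟩
  exact hζ.neZero'.out

end MulChar

section GaussSums

variable {k K : Type*} [Field k] [Fintype k] [Field K] {ψ : AddChar k K}

lemma natCast_card_ne_zero_of_addChar_ne_one (hψ : ψ ≠ 1) : (Fintype.card k : K) ≠ 0 := by
  obtain ⟨p, _⟩ := CharP.exists k
  obtain ⟨n, hp, hcard⟩ := FiniteField.card k p
  have : Fact p.Prime := ⟨hp⟩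
  intro h
  rw [hcard, Nat.cast_pow, pow_eq_zero_iff n.ne_zero] at h
  have : CharP K p := (CharP.charP_iff_prime_eq_zero hp).2 h
  refine hψ (DFunLike.ext _ _ fun x => frobenius_inj K p ?_)
  rw [frobenius_def, ← AddChar.map_nsmul_eq_pow, nsmul_eq_mul, CharP.cast_eq_zero, zero_mul,
    AddChar.map_zero_eq_one, AddChar.one_apply, map_one]

lemma g_one (hψ : ψ ≠ 1) : g ψ (1 : MulChar k K) = 1 := by
  rw [g, gaussSum_one_left hψ, neg_neg]

lemma gCirc_one (hψ : ψ ≠ 1) : gCirc ψ (1 : MulChar k K) = Fintype.card k := by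
  rw [gCirc, if_pos rfl, pow_one, g_one hψ, mul_one]

lemma gCirc_of_ne_one {χ : MulChar k K} (hχ : χ ≠ 1) : gCirc ψ χ = g ψ χ := by
  rw [gCirc, if_neg hχ, pow_zero, one_mul]

lemma g_mul_g (χ η : MulChar k K) :
    g ψ χ * g ψ η = ∑ s, ∑ t, χ s * η t * ψ (s + t) := by
  rw [g, g, neg_mul_neg, gaussSum, gaussSum, sum_mul_sum]
  refine sum_congr rfl fun s _ => sum_congr rfl fun t _ => ?_
  rw [AddChar.map_add_eq_mul]
  ring

lemma gCirc_mul_g_inv (hψ : ψ ≠ 1) (χ : MulChar k K) :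
    gCirc ψ χ * g ψ χ⁻¹ = χ (-1) * (Fintype.card k : K) := by
  rcases eq_or_ne χ 1 with rfl | hχ
  · rw [gCirc_one hψ, inv_one, g_one hψ, MulChar.one_apply isUnit_one.neg, one_mul, mul_one]
  · have h := mul_gaussSum_inv_eq_gaussSum χ⁻¹ ψ
    rw [mulChar_inv_apply_neg_one] at h
    rw [gCirc_of_ne_one hχ, g, g, neg_mul_neg, ← h,
      ← gaussSum_mul_gaussSum_eq_card hχ (AddChar.IsPrimitive.of_ne_one hψ)]
    ring

lemma g_ne_zero (hψ : ψ ≠ 1) (χ : MulChar k K) : g ψ χ ≠ 0 := by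
  have h := gCirc_mul_g_inv hψ χ⁻¹
  rw [inv_inv] at h
  exact right_ne_zero_of_mul (h ▸ mul_ne_zero (mulChar_apply_ne_zero _ (neg_ne_zero.2 one_ne_zero))
    (natCast_card_ne_zero_of_addChar_ne_one hψ))

lemma gCirc_ne_zero (hψ : ψ ≠ 1) (χ : MulChar k K) : gCirc ψ χ ≠ 0 :=
  mul_ne_zero (pow_ne_zero _ (natCast_card_ne_zero_of_addChar_ne_one hψ)) (g_ne_zero hψ χ)

lemma inv_gCirc (hψ : ψ ≠ 1) (χ : MulChar k K) :
    (gCirc ψ χ)⁻¹ = χ (-1) * g ψ χ⁻¹ / (Fintype.card k : K) := by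
  rw [eq_div_iff (natCast_card_ne_zero_of_addChar_ne_one hψ), inv_mul_eq_iff_eq_mul₀
    (gCirc_ne_zero hψ χ), mul_left_comm, gCirc_mul_g_inv hψ, ← mul_assoc,
    mulChar_apply_neg_one_mul_self, one_mul]

lemma j_eq_g_mul_g_div_gCirc (hψ : ψ ≠ 1) {χ : MulChar k K} (hχ : χ ≠ 1) (η : MulChar k K) :
    j χ η = g ψ χ * g ψ η / gCirc ψ (χ * η) := by
  rw [eq_div_iff (gCirc_ne_zero hψ _)]
  rcases eq_or_ne (χ * η) 1 with h | h
  · rw [eq_inv_of_mul_eq_one_right h, ← gCirc_of_ne_one hχ, gCirc_mul_g_inv hψ, mul_inv_cancel,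
      gCirc_one hψ, j, jacobiSum_nontrivial_inv hχ, neg_neg]
  · rw [gCirc_of_ne_one h, j, g, g, g]
    linear_combination jacobiSum_mul_nontrivial h ψ

lemma sum_mulChar_mul_addChar {χ : MulChar k K} (hχ : χ ≠ 1) (z : k) :
    ∑ x, χ x * ψ (x * z) = -(g ψ χ * χ⁻¹ z) := by
  rcases eq_or_ne z 0 with rfl | hz
  · simp [MulChar.sum_eq_zero_of_ne_one hχ, MulChar.map_zero]
  · have h := gaussSum_mulShift_eq χ ψ (Units.mk0 z hz)
    rw [Units.val_mk0] at h
    simp_rw [g, neg_mul, neg_neg, mul_comm (gaussSum χ ψ), ← h, gaussSum,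
      AddChar.mulShift_apply, mul_comm]

end GaussSums

section IntegralRepresentation

variable {k K : Type*} [Field k] [Fintype k] [Field K]

/-- The Kloosterman sum `∑_u χ(u) ψ(u + c / u)` twisted by the character `χ`. As a function of `c`
it is, up to a factor, the inverse Mellin transform of a product of two Gauss sums; the junk value
of `c / u` at `u = 0` is harmless as `χ(0) = 0`. -/
noncomputable def kloosterman (ψ : AddChar k K) (χ : MulChar k K) (c : k) : K :=
  ∑ u, χ u * ψ (u + c / u)

variable {ψ : AddChar k K}

lemma sum_mul_mul_kloosterman_eq (α β δ₁ δ₂ : MulChar k K) (z₁ : k) {z₂ : k} (hz₂ : z₂ ≠ 0) :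
    ∑ s, ∑ t, α s * β t * ψ (s + t) * kloosterman ψ (α * δ₁)⁻¹ (s * t * z₁) *
        kloosterman ψ (β * δ₂)⁻¹ (s * t * z₂) =
      (α * β) (-1) * (β * δ₂)⁻¹ z₂ * ∑ w, ∑ n, (α * (β * δ₂)⁻¹) w * β n *
        (∑ p, δ₁⁻¹ p * ψ (p * (1 + n - w))) *
        ∑ r, δ₂⁻¹ r * ψ (r * (-n + w * z₂ + w * n * z₁)) := by
  simp only [kloosterman, sum_mul_sum_mul_sum_comm]
  rw [mul_sum]
  refine sum_congr rfl fun p _ => ?_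
  rcases eq_or_ne p 0 with rfl | hp
  · simp [MulChar.map_zero]
  -- The monomial substitution `s = -p w`, `t = -r n` and `w z₂ r` for the second inner variable.
  rw [← sum_comp_mul_left (neg_ne_zero.2 hp), mul_sum]
  refine sum_congr rfl fun w _ => ?_
  rcases eq_or_ne w 0 with rfl | hw
  · simp [MulChar.map_zero]
  rw [← sum_comp_mul_left (mul_ne_zero hw hz₂), mul_sum]
  refine sum_congr rfl fun r _ => ?_
  rcases eq_or_ne r 0 with rfl | hr
  · simp [MulChar.map_zero]
  rw [← sum_comp_mul_left (neg_ne_zero.2 hr), mul_sum]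
  refine sum_congr rfl fun n _ => ?_
  have phase : ψ (-p * w + -r * n) * ψ (p + -p * w * (-r * n) * z₁ / p) *
      ψ (w * z₂ * r + -p * w * (-r * n) * z₂ / (w * z₂ * r)) =
      ψ (p * (1 + n - w)) * ψ (r * (-n + w * z₂ + w * n * z₁)) := by
    simp only [← AddChar.map_add_eq_mul]
    congr 1
    field_simp
    ring
  have hα := mul_inv_cancel₀ (mulChar_apply_ne_zero α hp)
  have hβ := mul_inv_cancel₀ (mulChar_apply_ne_zero β hr)
  simp only [mul_inv, MulChar.mul_apply, map_mul, mulChar_apply_neg _ p, mulChar_apply_neg _ r,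
    MulChar.inv_apply_eq_inv']
  linear_combination (α (-1) * α w * β (-1) * β n * (β w)⁻¹ * (δ₂ w)⁻¹ * (β z₂)⁻¹ * (δ₂ z₂)⁻¹ *
    (δ₁ p)⁻¹ * (δ₂ r)⁻¹) * (α p * (α p)⁻¹ * (β r * (β r)⁻¹) * phase +
      ψ (p * (1 + n - w)) * ψ (r * (-n + w * z₂ + w * n * z₁)) * (hα * (β r * (β r)⁻¹) + hβ))

lemma inv_pochCirc_mul_pochCirc_one (hψ : ψ ≠ 1) (γ ν : MulChar k K) :
    (pochCirc ψ γ ν * pochCirc ψ 1 ν)⁻¹ =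
      gCirc ψ γ * γ (-1) / (Fintype.card k : K) * (g ψ (γ * ν)⁻¹ * g ψ ν⁻¹) := by
  have hq := natCast_card_ne_zero_of_addChar_ne_one hψ
  rw [pochCirc, pochCirc, one_mul, gCirc_one hψ, mul_inv, inv_div, inv_div, div_eq_mul_inv,
    div_eq_mul_inv (Fintype.card k : K), inv_gCirc hψ, inv_gCirc hψ, MulChar.mul_apply]
  field_simp
  linear_combination (gCirc ψ γ * γ (-1) * g ψ (γ * ν)⁻¹ * g ψ ν⁻¹) *
    mulChar_apply_neg_one_mul_self ν

section

variable [Fintype (MulChar k K)]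

lemma F4_eq_sum (hψ : ψ ≠ 1) (α β γ₁ γ₂ : MulChar k K) (z₁ z₂ : k) :
    F4 ψ α β γ₁ γ₂ z₁ z₂ =
      1 / (1 - (Fintype.card k : K)) ^ 2 * (gCirc ψ γ₁ * γ₁ (-1) * (gCirc ψ γ₂ * γ₂ (-1)) /
        ((Fintype.card k : K) ^ 2 * g ψ α * g ψ β)) *
        ∑ ν₁ : MulChar k K, ∑ ν₂ : MulChar k K, g ψ (α * (ν₁ * ν₂)) * g ψ (β * (ν₁ * ν₂)) *
          (g ψ (γ₁ * ν₁)⁻¹ * g ψ ν₁⁻¹ * ν₁ z₁) * (g ψ (γ₂ * ν₂)⁻¹ * g ψ ν₂⁻¹ * ν₂ z₂) := by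
  rw [F4, finsum_eq_sum_of_fintype, Fintype.sum_prod_type, mul_assoc]
  simp only [mul_sum]
  refine sum_congr rfl fun ν₁ _ => sum_congr rfl fun ν₂ _ => ?_
  congr 1
  have split : pochCirc ψ γ₁ ν₁ * pochCirc ψ γ₂ ν₂ * pochCirc ψ 1 ν₁ * pochCirc ψ 1 ν₂ =
      (pochCirc ψ γ₁ ν₁ * pochCirc ψ 1 ν₁) * (pochCirc ψ γ₂ ν₂ * pochCirc ψ 1 ν₂) := by ring
  rw [split, poch, poch, div_eq_mul_inv _ (_ * _ : K), mul_inv,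
    inv_pochCirc_mul_pochCirc_one hψ, inv_pochCirc_mul_pochCirc_one hψ]
  simp only [div_eq_mul_inv, mul_inv]
  ring

lemma sum_sum_g_mul_g_mul_mul (α β : MulChar k K) (h₁ h₂ : MulChar k K → K) :
    ∑ ν₁, ∑ ν₂, g ψ (α * (ν₁ * ν₂)) * g ψ (β * (ν₁ * ν₂)) * h₁ ν₁ * h₂ ν₂ =
      ∑ s, ∑ t, α s * β t * ψ (s + t) * (∑ ν₁ : MulChar k K, h₁ ν₁ * ν₁ (s * t)) *
        ∑ ν₂ : MulChar k K, h₂ ν₂ * ν₂ (s * t) := by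
  rw [sum_mul_sum_mul_sum_comm]
  refine sum_congr rfl fun ν₁ _ => ?_
  rw [sum_comm]
  refine sum_congr rfl fun ν₂ _ => ?_
  simp_rw [g_mul_g, sum_mul]
  refine sum_congr rfl fun s _ => sum_congr rfl fun t _ => ?_
  simp only [MulChar.mul_apply, map_mul]
  ring

variable [HasEnoughRootsOfUnity K (Monoid.exponent kˣ)]

lemma sum_g_mul_g_mul_apply (γ : MulChar k K) {c : k} (hc : c ≠ 0) :
    ∑ ν : MulChar k K, g ψ (γ * ν)⁻¹ * g ψ ν⁻¹ * ν c =
      ((Fintype.card k : K) - 1) * kloosterman ψ γ⁻¹ c := by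
  have expand (ν : MulChar k K) : g ψ (γ * ν)⁻¹ * g ψ ν⁻¹ * ν c =
      ∑ u, ∑ w, γ⁻¹ u * ψ (u + w) * ν (c / (u * w)) := by
    simp only [g_mul_g, sum_mul, mul_inv, MulChar.mul_apply, MulChar.inv_apply_eq_inv',
      mulChar_apply_div, map_mul]
    refine sum_congr rfl fun u _ => sum_congr rfl fun w _ => ?_
    rw [div_eq_mul_inv, mul_inv]
    ring
  simp_rw [expand]
  rw [sum_comm, kloosterman, mul_sum]
  refine sum_congr rfl fun u _ => ?_
  rcases eq_or_ne u 0 with rfl | hu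
  · simp [MulChar.map_zero]
  rw [sum_comm]
  simp_rw [← mul_sum]
  rw [Fintype.sum_eq_single (c / u), mul_div_cancel₀ c hu, div_self hc, sum_mulChar_apply_one,
    mul_comm]
  intro w hw
  rw [sum_mulChar_apply_eq_zero, mul_zero]
  intro h
  have huw : u * w ≠ 0 := fun h0 => by simp [h0] at h
  exact hw (by rw [eq_div_iff hu, mul_comm, ← (div_eq_one_iff_eq huw).1 h])

end

variable [HasEnoughRootsOfUnity K (Monoid.exponent kˣ)]

lemma F4_eq_sum_kloosterman (hψ : ψ ≠ 1) (α β γ₁ γ₂ : MulChar k K) {z₁ z₂ : k} (hz₁ : z₁ ≠ 0)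
    (hz₂ : z₂ ≠ 0) :
    F4 ψ α β γ₁ γ₂ z₁ z₂ =
      gCirc ψ γ₁ * γ₁ (-1) * (gCirc ψ γ₂ * γ₂ (-1)) / ((Fintype.card k : K) ^ 2 * g ψ α * g ψ β) *
        ∑ s, ∑ t, α s * β t * ψ (s + t) * kloosterman ψ γ₁⁻¹ (s * t * z₁) *
          kloosterman ψ γ₂⁻¹ (s * t * z₂) := by
  let : Fintype (MulChar k K) := Fintype.ofFinite _
  rw [F4_eq_sum hψ, sum_sum_g_mul_g_mul_mul α β]
  have mellin (γ : MulChar k K) {x z : k} (hx : x ≠ 0) (hz : z ≠ 0) :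
      ∑ ν : MulChar k K, g ψ (γ * ν)⁻¹ * g ψ ν⁻¹ * ν z * ν x =
        ((Fintype.card k : K) - 1) * kloosterman ψ γ⁻¹ (x * z) := by
    rw [← sum_g_mul_g_mul_apply γ (mul_ne_zero hx hz)]
    refine sum_congr rfl fun ν _ => ?_
    rw [map_mul]
    ring
  have inner (s t : k) : α s * β t * ψ (s + t) *
      (∑ ν : MulChar k K, g ψ (γ₁ * ν)⁻¹ * g ψ ν⁻¹ * ν z₁ * ν (s * t)) *
      (∑ ν : MulChar k K, g ψ (γ₂ * ν)⁻¹ * g ψ ν⁻¹ * ν z₂ * ν (s * t)) =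
      (1 - (Fintype.card k : K)) ^ 2 * (α s * β t * ψ (s + t) *
        kloosterman ψ γ₁⁻¹ (s * t * z₁) * kloosterman ψ γ₂⁻¹ (s * t * z₂)) := by
    rcases eq_or_ne s 0 with rfl | hs
    · simp [MulChar.map_zero]
    rcases eq_or_ne t 0 with rfl | ht
    · simp [MulChar.map_zero]
    rw [mellin γ₁ (mul_ne_zero hs ht) hz₁, mellin γ₂ (mul_ne_zero hs ht) hz₂]
    ring
  have hq : 1 - (Fintype.card k : K) ≠ 0 := by
    have h := natCast_card_sub_one_ne_zero k K
    rw [Nat.cast_sub Fintype.card_pos, Nat.cast_one] at h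
    exact sub_ne_zero.2 (sub_ne_zero.1 h).symm
  simp_rw [inner, ← mul_sum]
  rw [← mul_assoc]
  congr 1
  field_simp

/-- The summand of the character sum over the `(w, n)`-plane which represents `J · F₄` for
`γ₁ = αδ₁` and `γ₂ = βδ₂`; the argument of `δ₂` is the equation of a conic. -/
noncomputable def conicTerm (α β δ₁ δ₂ : MulChar k K) (z₁ z₂ w n : k) : K :=
  (β * δ₂)⁻¹ z₂ * ((α * (β * δ₂)⁻¹) w * β n * δ₁ (1 + n - w) * δ₂ (-n + w * z₂ + w * n * z₁))

lemma J_mul_F4_eq_sum_conicTerm (hψ : ψ ≠ 1) {α β δ₁ δ₂ : MulChar k K} (hα : α ≠ 1) (hβ : β ≠ 1)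
    (hδ₁ : δ₁ ≠ 1) (hδ₂ : δ₂ ≠ 1) {z₁ z₂ : k} (hz₁ : z₁ ≠ 0) (hz₂ : z₂ ≠ 0) :
    J α β (α * δ₁) (β * δ₂) * F4 ψ α β (α * δ₁) (β * δ₂) z₁ z₂ =
      ∑ w, ∑ n, conicTerm α β δ₁ δ₂ z₁ z₂ w n := by
  have hq := natCast_card_ne_zero_of_addChar_ne_one hψ
  have h₁ := gCirc_ne_zero hψ (α * δ₁)
  have h₂ := gCirc_ne_zero hψ (β * δ₂)
  have h₃ := g_ne_zero hψ α
  have h₄ := g_ne_zero hψ β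
  have gauss {χ : MulChar k K} (hχ : χ ≠ 1) : χ (-1) * (g ψ χ * g ψ χ⁻¹) = Fintype.card k := by
    rw [← gCirc_of_ne_one hχ, gCirc_mul_g_inv hψ, ← mul_assoc, mulChar_apply_neg_one_mul_self,
      one_mul]
  have inner (w n : k) : (α * (β * δ₂)⁻¹) w * β n * (∑ p, δ₁⁻¹ p * ψ (p * (1 + n - w))) *
      ∑ r, δ₂⁻¹ r * ψ (r * (-n + w * z₂ + w * n * z₁)) =
      g ψ δ₁⁻¹ * g ψ δ₂⁻¹ * ((α * (β * δ₂)⁻¹) w * β n * δ₁ (1 + n - w) *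
        δ₂ (-n + w * z₂ + w * n * z₁)) := by
    rw [sum_mulChar_mul_addChar (inv_ne_one.2 hδ₁), sum_mulChar_mul_addChar (inv_ne_one.2 hδ₂),
      inv_inv, inv_inv]
    ring
  rw [J, inv_mul_cancel_left, inv_mul_cancel_left, j_eq_g_mul_g_div_gCirc hψ hα,
    j_eq_g_mul_g_div_gCirc hψ hβ, F4_eq_sum_kloosterman hψ α β _ _ hz₁ hz₂,
    sum_mul_mul_kloosterman_eq α β δ₁ δ₂ z₁ hz₂]
  simp_rw [conicTerm, inner, ← mul_sum]
  generalize ∑ w, ∑ n, (α * (β * δ₂)⁻¹) w * β n * δ₁ (1 + n - w) *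
    δ₂ (-n + w * z₂ + w * n * z₁) = E
  rw [MulChar.mul_apply α β, MulChar.mul_apply α δ₁, MulChar.mul_apply β δ₂]
  field_simp
  linear_combination (β * δ₂)⁻¹ z₂ * E * (α (-1) ^ 2 * β (-1) ^ 2 *
    ((Fintype.card k : K) * gauss hδ₁ + δ₁ (-1) * (g ψ δ₁ * g ψ δ₁⁻¹) * gauss hδ₂) +
    (Fintype.card k : K) ^ 2 * (mulChar_apply_neg_one_mul_self α +
      α (-1) ^ 2 * mulChar_apply_neg_one_mul_self β))

end IntegralRepresentation

section Plane

lemma inv_mul_mul_mul_mul_cancel {G : Type*} [CommGroup G] (a b c d : G) :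
    (a * b)⁻¹ * (a * c) * (b * d) = c * d := by
  rw [mul_assoc, mul_mul_mul_comm, inv_mul_cancel_left]

variable {k K : Type*} [Field k] [Field K]

/-- The value at `(u, v)` of the character attached to the equation of the surface, for
`γ₁ = αδ₁` and `γ₂ = βδ₂`. -/
noncomputable def surfaceTerm (α β δ₁ δ₂ : MulChar k K) (x y u v : k) : K :=
  α u * β v * δ₁ (1 - u) * δ₂ (1 - v) * (β * δ₁ * δ₂)⁻¹ (1 - x * u) *
    (α * δ₁ * δ₂)⁻¹ (1 - y * v) * (δ₁ * δ₂) (1 - x * u - y * v)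

/-- `surfaceTerm` in the coordinates `w = u / (1 - y v)` and `v`, extended by the same formula to
the line `1 - y v = 0`. -/
noncomputable def shearedTerm (α β δ₁ δ₂ : MulChar k K) (x y w v : k) : K :=
  α w * β v * δ₁ (1 - w + y * w * v) * δ₂ (1 - v) * (δ₁ * δ₂) (1 - x * w) *
    (β * δ₁ * δ₂)⁻¹ (x * y * w * v + (1 - x * w))

variable (α β δ₁ δ₂ : MulChar k K) {x y : k}

lemma surfaceTerm_eq_shearedTerm (x : k) {v : k} (w : k) (hv : 1 - y * v ≠ 0) :
    surfaceTerm α β δ₁ δ₂ x y ((1 - y * v) * w) v = shearedTerm α β δ₁ δ₂ x y w v := by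
  have hα := mulChar_apply_ne_zero α hv
  have hδ₁ := mulChar_apply_ne_zero δ₁ hv
  have hδ₂ := mulChar_apply_ne_zero δ₂ hv
  have e₁ : 1 - (1 - y * v) * w = 1 - w + y * w * v := by ring
  have e₂ : 1 - x * ((1 - y * v) * w) = x * y * w * v + (1 - x * w) := by ring
  have e₃ : x * y * w * v + (1 - x * w) - y * v = (1 - y * v) * (1 - x * w) := by ring
  rw [surfaceTerm, shearedTerm, e₂, e₁, e₃]
  simp only [mul_inv, MulChar.mul_apply, MulChar.inv_apply_eq_inv', map_mul]
  field_simp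

lemma shearedTerm_eq_conicTerm (hx : 1 - x ≠ 0) (hy : y ≠ 0) {w v : k} (hw : w ≠ 0)
    (hv : x * y * w * v + (1 - x * w) ≠ 0) :
    shearedTerm α β δ₁ δ₂ x y w v = conicTerm α β δ₁ δ₂ (x * (1 - y)) (y * (1 - x)) w
      (((1 - x) * y * w * v + 0) / (x * y * w * v + (1 - x * w))) := by
  set D := x * y * w * v + (1 - x * w) with hD
  have e₁ : 1 + ((1 - x) * y * w * v + 0) / D - w = (1 - x * w) * (1 - w + y * w * v) / D := by
    field_simp
    rw [hD]
    ring
  have e₂ : -(((1 - x) * y * w * v + 0) / D) + w * (y * (1 - x)) +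
      w * (((1 - x) * y * w * v + 0) / D) * (x * (1 - y)) =
      (1 - x) * y * w * (1 - x * w) * (1 - v) / D := by
    field_simp
    rw [hD]
    ring
  rw [conicTerm, e₁, e₂, add_zero, shearedTerm, ← hD]
  have hβx := mulChar_apply_ne_zero β hx
  have hβy := mulChar_apply_ne_zero β hy
  have hβw := mulChar_apply_ne_zero β hw
  have hδx := mulChar_apply_ne_zero δ₂ hx
  have hδy := mulChar_apply_ne_zero δ₂ hy
  have hδw := mulChar_apply_ne_zero δ₂ hw
  simp only [mul_inv, MulChar.mul_apply, MulChar.inv_apply_eq_inv', map_mul, mulChar_apply_div]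
  field_simp

variable [Fintype k]

lemma sum_conicTerm_line_infinity (hx : x ≠ 0) (hx' : 1 - x ≠ 0) :
    ∑ w, conicTerm α β δ₁ δ₂ (x * (1 - y)) (y * (1 - x)) w ((1 - x) / x) =
      -S0 α β (α * δ₁) (β * δ₂) x y := by
  have hβx := mulChar_apply_ne_zero β hx'
  have hδx := mulChar_apply_ne_zero δ₂ hx'
  have term (w : k) : conicTerm α β δ₁ δ₂ (x * (1 - y)) (y * (1 - x)) w ((1 - x) / x) =
      (β * δ₂)⁻¹ y * β⁻¹ x * δ₂ (-1) * ((α * (β * δ₂)⁻¹) w * (δ₁ * δ₂) (x⁻¹ - w)) := by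
    have e₁ : 1 + (1 - x) / x - w = x⁻¹ - w := by
      field_simp
      ring
    have e₂ : -((1 - x) / x) + w * (y * (1 - x)) + w * ((1 - x) / x) * (x * (1 - y)) =
        (1 - x) * (-1) * (x⁻¹ - w) := by
      field_simp
      ring
    rw [conicTerm, e₁, e₂]
    simp only [mul_inv, MulChar.mul_apply, MulChar.inv_apply_eq_inv', map_mul, mulChar_apply_div]
    field_simp
  have dual : (α * (β * δ₂)⁻¹ * (δ₁ * δ₂))⁻¹ = β * (α * δ₁)⁻¹ := by
    rw [mul_inv β, inv_eq_iff_mul_eq_one]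
    calc α * (β⁻¹ * δ₂⁻¹) * (δ₁ * δ₂) * (β * (α * δ₁)⁻¹)
        = (α * δ₁) * (α * δ₁)⁻¹ * (β * β⁻¹) * (δ₂ * δ₂⁻¹) := by ac_rfl
      _ = 1 := by simp only [mul_inv_cancel, mul_one]
  simp_rw [term]
  rw [← mul_sum, sum_mulChar_mul_mulChar_sub _ _ (inv_ne_zero hx),
    jacobiSum_eq_apply_neg_one_mul_jacobiSum, dual, ← MulChar.inv_apply', dual, S0, j]
  generalize jacobiSum (α * (β * δ₂)⁻¹) (β * (α * δ₁)⁻¹) = I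
  have hβ := mulChar_apply_ne_zero β hx
  simp only [mul_inv, MulChar.mul_apply, mulChar_inv_apply_neg_one, MulChar.inv_apply_eq_inv' β x]
  field_simp
  linear_combination (β⁻¹ y * δ₂⁻¹ y * α (-1) * β (-1) * α⁻¹ x * δ₁⁻¹ x * I) *
    mulChar_apply_neg_one_mul_self δ₂

lemma sum_conicTerm_line_left (hx : x ≠ 0) (hx' : 1 - x ≠ 0) (hy : y ≠ 0) :
    ∑ n, conicTerm α β δ₁ δ₂ (x * (1 - y)) (y * (1 - x)) x⁻¹ n =
      -S1 α β (α * δ₁) (β * δ₂) x y := by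
  have term (n : k) : conicTerm α β δ₁ δ₂ (x * (1 - y)) (y * (1 - x)) x⁻¹ n =
      (β * δ₂)⁻¹ (y * (1 - x)) * (α * (β * δ₂)⁻¹) x⁻¹ * δ₁ (-1) * δ₂ y *
        (β n * (δ₁ * δ₂) ((1 - x) / x - n)) := by
    have e₁ : 1 + n - x⁻¹ = (-1) * ((1 - x) / x - n) := by
      field_simp
      ring
    have e₂ : -n + x⁻¹ * (y * (1 - x)) + x⁻¹ * n * (x * (1 - y)) = y * ((1 - x) / x - n) := by
      field_simp
      ring
    rw [conicTerm, e₁, e₂, map_mul δ₁, map_mul δ₂, MulChar.mul_apply δ₁]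
    ring
  simp_rw [term]
  rw [← mul_sum, sum_mulChar_mul_mulChar_sub _ _ (div_ne_zero hx' hx), S1, j,
    inv_mul_mul_mul_mul_cancel, jacobiSum_comm, inv_mul_cancel_left,
    show x - 1 = (-1) * (1 - x) by ring]
  generalize jacobiSum (δ₁ * δ₂) β = I
  have hβx := mulChar_apply_ne_zero β hx
  have hβx' := mulChar_apply_ne_zero β hx'
  have hδ₁x := mulChar_apply_ne_zero δ₁ hx
  have hδ₂x := mulChar_apply_ne_zero δ₂ hx
  have hδ₂x' := mulChar_apply_ne_zero δ₂ hx'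
  have hδ₂y := mulChar_apply_ne_zero δ₂ hy
  simp only [mul_inv, MulChar.mul_apply, MulChar.inv_apply_eq_inv', map_mul, mulChar_apply_inv,
    mulChar_apply_div]
  field_simp

lemma sum_shearedTerm_line_infinity (hx : x ≠ 0) (hy : y ≠ 0) :
    ∑ w, shearedTerm α β δ₁ δ₂ x y w y⁻¹ = -S2 α β (α * δ₁) (β * δ₂) x y := by
  have term (w : k) : shearedTerm α β δ₁ δ₂ x y (x⁻¹ * w) y⁻¹ =
      (β * δ₂)⁻¹ y * δ₂ (y - 1) * α⁻¹ x * (α w * (δ₁ * δ₂) (1 - w)) := by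
    have e₁ : 1 - x⁻¹ * w + y * (x⁻¹ * w) * y⁻¹ = 1 := by
      field_simp
      ring
    have e₂ : 1 - y⁻¹ = (y - 1) / y := by rw [sub_div, div_self hy, one_div]
    have e₃ : x * y * (x⁻¹ * w) * y⁻¹ + (1 - x * (x⁻¹ * w)) = 1 := by
      field_simp
      ring
    rw [shearedTerm, e₁, e₂, e₃, mul_inv_cancel_left₀ hx]
    simp only [mul_inv, MulChar.mul_apply, MulChar.inv_apply_eq_inv', map_mul, mulChar_apply_inv,
      mulChar_apply_div, map_one]
    ring
  rw [← sum_comp_mul_left (inv_ne_zero hx)]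
  simp_rw [term]
  rw [← mul_sum, ← jacobiSum, S2, inv_mul_mul_mul_mul_cancel, inv_mul_cancel_left, j,
    jacobiSum_comm]
  ring

lemma sum_shearedTerm [DecidableEq k] (hx : x ≠ 0) (hx' : 1 - x ≠ 0) (hy : y ≠ 0) (w : k) :
    ∑ v, shearedTerm α β δ₁ δ₂ x y w v =
      ∑ n, conicTerm α β δ₁ δ₂ (x * (1 - y)) (y * (1 - x)) w n -
        conicTerm α β δ₁ δ₂ (x * (1 - y)) (y * (1 - x)) w ((1 - x) / x) -
        if w = x⁻¹ then ∑ n, conicTerm α β δ₁ δ₂ (x * (1 - y)) (y * (1 - x)) w n else 0 := by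
  rcases eq_or_ne w 0 with rfl | hw
  · simp [shearedTerm, conicTerm, MulChar.map_zero]
  rcases eq_or_ne w x⁻¹ with rfl | hwx
  · have e : 1 + (1 - x) / x - x⁻¹ = 0 := by
      field_simp
      ring
    simp [shearedTerm, conicTerm, e, mul_inv_cancel₀ hx, MulChar.map_zero]
  have hxw : 1 - x * w ≠ 0 := fun h => hwx (eq_inv_of_mul_eq_one_right (sub_eq_zero.1 h).symm)
  have hc : x * y * w ≠ 0 := mul_ne_zero (mul_ne_zero hx hy) hw
  have hac : (1 - x) * y * w / (x * y * w) = (1 - x) / x := by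
    rw [mul_div_mul_right _ _ hw, mul_div_mul_right _ _ hy]
  rw [if_neg hwx, sub_zero, ← hac]
  refine sum_eq_sum_sub_of_mobius hc (by simpa using ⟨⟨⟨hx', hy⟩, hw⟩, hxw⟩) (fun v hv => ?_)
    fun v hv => shearedTerm_eq_conicTerm α β δ₁ δ₂ hx' hy hw hv
  rw [shearedTerm, hv, MulChar.map_zero, mul_zero]

lemma sum_surfaceTerm [DecidableEq k] (hy : y ≠ 0) (v : k) :
    ∑ u, surfaceTerm α β δ₁ δ₂ x y u v = ∑ w, shearedTerm α β δ₁ δ₂ x y w v -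
      if v = y⁻¹ then ∑ w, shearedTerm α β δ₁ δ₂ x y w v else 0 := by
  rcases eq_or_ne v y⁻¹ with rfl | hv
  · simp [surfaceTerm, mul_inv_cancel₀ hy, MulChar.map_zero]
  have hyv : 1 - y * v ≠ 0 := fun h => hv (eq_inv_of_mul_eq_one_right (sub_eq_zero.1 h).symm)
  rw [if_neg hv, sub_zero, ← sum_comp_mul_left hyv]
  exact sum_congr rfl fun w _ => surfaceTerm_eq_shearedTerm α β δ₁ δ₂ x w hyv

lemma sum_surfaceTerm_eq_sum_conicTerm (hx : x ≠ 0) (hx' : 1 - x ≠ 0) (hy : y ≠ 0) :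
    ∑ u, ∑ v, surfaceTerm α β δ₁ δ₂ x y u v =
      ∑ w, ∑ n, conicTerm α β δ₁ δ₂ (x * (1 - y)) (y * (1 - x)) w n +
        (S0 α β (α * δ₁) (β * δ₂) x y + S1 α β (α * δ₁) (β * δ₂) x y +
          S2 α β (α * δ₁) (β * δ₂) x y) := by
  classical
  rw [sum_comm]
  simp_rw [sum_surfaceTerm α β δ₁ δ₂ hy]
  rw [sum_sub_distrib, Fintype.sum_ite_eq', sum_comm]
  simp_rw [sum_shearedTerm α β δ₁ δ₂ hx hx' hy]
  rw [sum_sub_distrib, sum_sub_distrib, Fintype.sum_ite_eq',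
    sum_conicTerm_line_infinity α β δ₁ δ₂ hx hx', sum_conicTerm_line_left α β δ₁ δ₂ hx hx' hy,
    sum_shearedTerm_line_infinity α β δ₁ δ₂ hx hy]
  ring

variable {α β δ₁ δ₂}

lemma sum_surfaceTerm_eq_rhs4 [HasEnoughRootsOfUnity K (Monoid.exponent kˣ)] {ψ : AddChar k K}
    (hψ : ψ ≠ 1) (hα : α ≠ 1) (hβ : β ≠ 1) (hδ₁ : δ₁ ≠ 1) (hδ₂ : δ₂ ≠ 1) (hx : x ≠ 0)
    (hx₁ : x ≠ 1) (hy : y ≠ 0) (hy₁ : y ≠ 1) :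
    ∑ u, ∑ v, surfaceTerm α β δ₁ δ₂ x y u v = rhs4 ψ α β (α * δ₁) (β * δ₂) x y := by
  have hx' : 1 - x ≠ 0 := sub_ne_zero.2 hx₁.symm
  have hy' : 1 - y ≠ 0 := sub_ne_zero.2 hy₁.symm
  rw [rhs4, J_mul_F4_eq_sum_conicTerm hψ hα hβ hδ₁ hδ₂ (mul_ne_zero hx hy') (mul_ne_zero hy hx'),
    sum_surfaceTerm_eq_sum_conicTerm α β δ₁ δ₂ hx hx' hy]

end Plane

section TwistedRoots

variable {k : Type*} [Field k] [Fintype k]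

lemma mem_range_algebraMap_of_pow_card_eq {L : Type*} [Field L] [Algebra k L] {z : L}
    (hz : z ^ Fintype.card k = z) : z ∈ (algebraMap k L).range := by
  refine Polynomial.splits_X_pow_nat_card_sub_X.mem_range_of_isRoot ?_ ?_
  · exact FiniteField.X_pow_card_sub_X_ne_zero k Finite.one_lt_card
  · simp [Nat.card_eq_fintype_card, hz]

variable {d : ℕ}

lemma pos_of_dvd_card_sub_one (hd : d ∣ Fintype.card k - 1) : 0 < d :=
  Nat.pos_of_dvd_of_pos hd (Nat.sub_pos_of_lt Fintype.one_lt_card)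

lemma natCard_rootsOfUnity_of_dvd_card_sub_one (hd : d ∣ Fintype.card k - 1) :
    Nat.card (rootsOfUnity d k) = d := by
  rw [← Nat.card_eq_fintype_card, ← Nat.card_units] at hd
  exact (IsCyclic.card_powMonoidHom_ker (G := kˣ) d).trans (Nat.gcd_eq_right hd)

/-- The power residue symbol `u ↦ u ^ ((q - 1) / d)`, with values in `μ_d`. -/
def powerResidue (hd : d ∣ Fintype.card k - 1) : kˣ →* rootsOfUnity d k :=
  (powMonoidHom ((Fintype.card k - 1) / d)).codRestrict (rootsOfUnity d k) fun u => by
    rw [powMonoidHom_apply, mem_rootsOfUnity, ← pow_mul, Nat.div_mul_cancel hd,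
      ← Nat.card_eq_fintype_card, ← Nat.card_units, pow_card_eq_one']

/-- The points of the fibre `y ^ d = c` on which Frobenius acts as `ξ`. -/
abbrev TwistedRoots (d : ℕ) (c : k) (ξ : rootsOfUnity d k) : Type _ :=
  {y : AlgebraicClosure k // y ^ d = algebraMap k _ c ∧
    y ^ Fintype.card k = algebraMap k _ ((ξ : kˣ) : k) * y}

lemma finite_twistedRoots (hd : 0 < d) (c : k) (ξ : rootsOfUnity d k) :
    Finite (TwistedRoots d c ξ) := by
  classical
  refine (Finset.finite_toSet (Polynomial.nthRoots d (algebraMap k _ c)).toFinset).subset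
    fun y hy => ?_
  rw [mem_coe, Multiset.mem_toFinset, Polynomial.mem_nthRoots hd]
  exact hy.1

lemma natCard_twistedRoots_zero (hd : d ≠ 0) (ξ : rootsOfUnity d k) :
    Nat.card (TwistedRoots d (0 : k) ξ) = 1 := by
  have eq_zero (y : TwistedRoots d (0 : k) ξ) : y.1 = 0 :=
    eq_zero_of_pow_eq_zero (y.2.1.trans (map_zero _))
  exact Nat.card_eq_one_iff_unique.2
    ⟨⟨fun y y' => Subtype.ext ((eq_zero y).trans (eq_zero y').symm)⟩, ⟨0, by simp [hd], by simp⟩⟩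

lemma pow_card_eq_of_pow_eq (hd : d ∣ Fintype.card k - 1) {u : kˣ} {y : AlgebraicClosure k}
    (hy : y ^ d = algebraMap k _ (u : k)) :
    y ^ Fintype.card k = algebraMap k _ ((powerResidue hd u : kˣ) : k) * y := by
  change _ = algebraMap k _ ((u ^ ((Fintype.card k - 1) / d) : kˣ) : k) * y
  rw [Units.val_pow_eq_pow_val, map_pow, ← hy, ← pow_mul, Nat.mul_div_cancel' hd, ← pow_succ,
    Nat.sub_add_cancel Fintype.card_pos]

lemma natCard_twistedRoots_powerResidue (hd : d ∣ Fintype.card k - 1) (u : kˣ) :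
    Nat.card (TwistedRoots d (u : k) (powerResidue hd u)) = d := by
  classical
  have hd0 := pos_of_dvd_card_sub_one hd
  have : NeZero d := ⟨hd0.ne'⟩
  obtain ⟨ζ, hζ⟩ : ∃ ζ : k, IsPrimitiveRoot ζ d := by
    rw [← card_rootsOfUnity_eq_iff_exists_isPrimitiveRoot,
      natCard_rootsOfUnity_of_dvd_card_sub_one hd]
  replace hζ := hζ.map_of_injective (algebraMap k (AlgebraicClosure k)).injective
  have hu : algebraMap k (AlgebraicClosure k) u ≠ 0 := by simp
  let e : TwistedRoots d (u : k) (powerResidue hd u) ≃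
      (Polynomial.nthRoots d (algebraMap k (AlgebraicClosure k) u)).toFinset :=
    Equiv.subtypeEquivRight fun y => by
      rw [Multiset.mem_toFinset, Polynomial.mem_nthRoots hd0]
      exact ⟨And.left, fun hy => ⟨hy, pow_card_eq_of_pow_eq hd hy⟩⟩
  rw [Nat.card_congr e, Nat.card_eq_fintype_card, Fintype.card_coe,
    Multiset.toFinset_card_of_nodup (hζ.nthRoots_nodup hu), hζ.card_nthRoots,
    if_pos (IsAlgClosed.exists_pow_nat_eq _ hd0)]

lemma natCard_twistedRoots_of_ne (hd : d ∣ Fintype.card k - 1) {u : kˣ} {ξ : rootsOfUnity d k}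
    (hξ : ξ ≠ powerResidue hd u) : Nat.card (TwistedRoots d (u : k) ξ) = 0 := by
  have : IsEmpty (TwistedRoots d (u : k) ξ) := by
    refine ⟨fun ⟨y, hy, hyξ⟩ => hξ ?_⟩
    have hy0 : y ≠ 0 := by
      rintro rfl
      rw [zero_pow (pos_of_dvd_card_sub_one hd).ne'] at hy
      exact u.ne_zero ((map_eq_zero _).1 hy.symm)
    have h := mul_right_cancel₀ hy0 (hyξ.symm.trans (pow_card_eq_of_pow_eq hd hy))
    exact Subtype.ext (Units.ext ((algebraMap k _).injective h))
  exact Nat.card_of_isEmpty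

end TwistedRoots

section TwistedPoints

variable {k : Type*} [Field k] [Fintype k] {d : ℕ} (f : MvPolynomial (Fin 2) k)
  (ξ : rootsOfUnity d k)

/-- The point of the surface `y ^ d = f(x)` over `x ∈ k²` given by a twisted root of `f(x)`. -/
noncomputable def twistedPoint (p : Σ x : Fin 2 → k, TwistedRoots d (MvPolynomial.eval x f) ξ) :
    {P : CyclicSurface d f // CyclicSurface.frob^[1] P = ξ • P} where
  val :=
    { x := fun i => algebraMap k _ (p.1 i)
      y := p.2.1
      eqn := p.2.2.1.trans (MvPolynomial.aeval_algebraMap_apply _ p.1 f).symm }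
  property := by
    refine CyclicSurface.ext (funext fun i => ?_) p.2.2.2
    change algebraMap k _ (p.1 i) ^ Fintype.card k = algebraMap k _ (p.1 i)
    rw [← map_pow, FiniteField.pow_card]

lemma twistedPoint_bijective : Function.Bijective (twistedPoint f ξ) := by
  constructor
  · rintro ⟨x, y⟩ ⟨x', y'⟩ h
    have hP := congrArg Subtype.val h
    obtain rfl : x = x' := funext fun i =>
      (algebraMap k (AlgebraicClosure k)).injective (congrFun (congrArg CyclicSurface.x hP) i)
    obtain rfl : y = y' := Subtype.ext (congrArg CyclicSurface.y hP)
    rfl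
  · rintro ⟨P, hP⟩
    choose x hx using fun i =>
      mem_range_algebraMap_of_pow_card_eq (congrFun (congrArg CyclicSurface.x hP) i)
    have hy : P.y ^ d = algebraMap k _ (MvPolynomial.eval x f) := by
      rw [P.eqn, ← funext hx]
      exact MvPolynomial.aeval_algebraMap_apply _ x f
    exact ⟨⟨x, P.y, hy, congrArg CyclicSurface.y hP⟩,
      Subtype.ext (CyclicSurface.ext (funext hx) rfl)⟩

lemma natCard_twistedPoints (hd : 0 < d) :
    Nat.card {P : CyclicSurface d f // CyclicSurface.frob^[1] P = ξ • P} =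
      ∑ x : Fin 2 → k, Nat.card (TwistedRoots d (MvPolynomial.eval x f) ξ) := by
  have (x : Fin 2 → k) := finite_twistedRoots hd (MvPolynomial.eval x f) ξ
  rw [← Nat.card_congr (Equiv.ofBijective _ (twistedPoint_bijective f ξ)), Nat.card_sigma]

end TwistedPoints

section PointCount

variable {k K : Type*} [Field k] [Fintype k] [Field K] {d : ℕ}

section Fibre

variable [Fintype (rootsOfUnity d k)]

lemma sum_mul_natCard_twistedRoots_zero (hd : d ≠ 0) (χ : rootsOfUnity d k →* Kˣ) :
    ∑ ξ, (χ ξ : K) * Nat.card (TwistedRoots d (0 : k) ξ) = ∑ ξ, (χ ξ : K) := by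
  simp only [natCard_twistedRoots_zero hd, Nat.cast_one, mul_one]

lemma sum_mul_natCard_twistedRoots_units (hd : d ∣ Fintype.card k - 1)
    (χ : rootsOfUnity d k →* Kˣ) (u : kˣ) :
    ∑ ξ, (χ ξ : K) * Nat.card (TwistedRoots d (u : k) ξ) = χ (powerResidue hd u) * d := by
  rw [Fintype.sum_eq_single (powerResidue hd u) fun ξ hξ => by
    rw [natCard_twistedRoots_of_ne hd hξ, Nat.cast_zero, mul_zero],
    natCard_twistedRoots_powerResidue]

lemma N_cyclicSurface_eq_sum (hd : d ∣ Fintype.card k - 1) (χ : rootsOfUnity d k →* Kˣ)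
    (f : MvPolynomial (Fin 2) k) :
    N (CyclicSurface d f) CyclicSurface.frob χ 1 =
      ∑ x : Fin 2 → k, 1 / (d : K) *
        ∑ ξ, (χ ξ : K) * Nat.card (TwistedRoots d (MvPolynomial.eval x f) ξ) := by
  simp_rw [N, finsum_eq_sum_of_fintype, natCard_rootsOfUnity_of_dvd_card_sub_one hd,
    natCard_twistedPoints f _ (pos_of_dvd_card_sub_one hd), Nat.cast_sum, mul_sum]
  exact sum_comm

end Fibre

lemma N_cyclicSurface_one (hd : d ∣ Fintype.card k - 1) (hdK : (d : K) ≠ 0)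
    (f : MvPolynomial (Fin 2) k) :
    N (CyclicSurface d f) CyclicSurface.frob (1 : rootsOfUnity d k →* Kˣ) 1 =
      (Fintype.card k : K) ^ 2 := by
  let := Fintype.ofFinite (rootsOfUnity d k)
  have fibre (c : k) :
      ∑ ξ, (((1 : rootsOfUnity d k →* Kˣ) ξ : Kˣ) : K) * Nat.card (TwistedRoots d c ξ) = d := by
    rcases eq_or_ne c 0 with rfl | hc
    · rw [sum_mul_natCard_twistedRoots_zero (pos_of_dvd_card_sub_one hd).ne']
      simp only [MonoidHom.one_apply, Units.val_one, sum_const, card_univ, nsmul_one,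
        ← Nat.card_eq_fintype_card, natCard_rootsOfUnity_of_dvd_card_sub_one hd]
    · lift c to kˣ using hc.isUnit
      rw [sum_mul_natCard_twistedRoots_units hd, MonoidHom.one_apply, Units.val_one, one_mul]
  simp_rw [N_cyclicSurface_eq_sum hd, fibre]
  simp [hdK]

lemma N_cyclicSurface_eq_sum_mulChar (hd : d ∣ Fintype.card k - 1) (hdK : (d : K) ≠ 0)
    (f : MvPolynomial (Fin 2) k) {χ : rootsOfUnity d k →* Kˣ} (hχ : χ ≠ 1) :
    N (CyclicSurface d f) CyclicSurface.frob χ 1 =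
      ∑ x, MulChar.ofUnitHom (χ.comp (powerResidue hd)) (MvPolynomial.eval x f) := by
  let := Fintype.ofFinite (rootsOfUnity d k)
  have hsum : ∑ ξ, (χ ξ : K) = 0 := by
    refine sum_hom_units_eq_zero ((Units.coeHom K).comp χ) fun h => hχ ?_
    ext ξ
    exact congrArg (fun f => f ξ) h
  rw [N_cyclicSurface_eq_sum hd]
  refine sum_congr rfl fun x _ => ?_
  generalize MvPolynomial.eval x f = c
  rcases eq_or_ne c 0 with rfl | hc
  · rw [sum_mul_natCard_twistedRoots_zero (pos_of_dvd_card_sub_one hd).ne', hsum, mul_zero,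
      MulChar.map_zero]
  · lift c to kˣ using hc.isUnit
    rw [sum_mul_natCard_twistedRoots_units hd, MulChar.ofUnitHom_coe, MonoidHom.comp_apply]
    field_simp

lemma ofUnitHom_chi_zpow_comp_powerResidue (hd : d ∣ Fintype.card k - 1) (φ : MulChar k K)
    (m : ℤ) : MulChar.ofUnitHom ((chi d φ ^ m).comp (powerResidue hd)) = phiD d φ ^ m := by
  ext u
  rw [MulChar.ofUnitHom_coe, MulChar.zpow_apply_coe, phiD, MulChar.pow_apply_coe,
    ← MulChar.coe_toUnitHom φ (u ^ m), map_zpow]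
  simp only [chi, powerResidue, MonoidHom.comp_apply, MonoidHom.zpow_apply,
    MonoidHom.codRestrict_apply, powMonoidHom_apply, Subgroup.coe_subtype, map_pow,
    Units.val_zpow_eq_zpow_val, Units.val_pow_eq_pow_val, MulChar.coe_toUnitHom]
  rw [← zpow_natCast, ← zpow_natCast, zpow_comm]

lemma N_cyclicSurface_chi_eq_sum (hd : d ∣ Fintype.card k - 1) (hdK : (d : K) ≠ 0)
    (f : MvPolynomial (Fin 2) k) {φ : MulChar k K} {m : ℤ} (hm : phiD d φ ^ m ≠ 1) :
    N (CyclicSurface d f) CyclicSurface.frob (chi d φ ^ m) 1 =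
      ∑ x, (phiD d φ ^ m) (MvPolynomial.eval x f) := by
  rw [← ofUnitHom_chi_zpow_comp_powerResidue hd] at hm ⊢
  refine N_cyclicSurface_eq_sum_mulChar hd hdK f fun h => hm ?_
  ext u
  simp [h]

end PointCount

section Generator

lemma chi_zpow_eq_one {k K : Type*} [Field k] [Field K] {d : ℕ} {m : ℤ} (hm : (d : ℤ) ∣ m)
    (φ : MulChar k K) : chi d φ ^ m = 1 := by
  obtain ⟨n, rfl⟩ := hm
  ext ξ
  have hξ : ξ ^ d = 1 := Subtype.ext ((mem_rootsOfUnity d _).1 ξ.2)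
  simp [MonoidHom.zpow_apply, zpow_mul, ← map_pow, hξ]

variable {k K : Type*} [Field k] [Fintype k] [Field K]
  [HasEnoughRootsOfUnity K (Monoid.exponent kˣ)] {d : ℕ}

lemma orderOf_phiD (hd : d ∣ Fintype.card k - 1) {φ : MulChar k K}
    (hφ : ∀ η : MulChar k K, η ∈ Subgroup.zpowers φ) : orderOf (phiD d φ) = d := by
  have h : orderOf φ = Fintype.card k - 1 := by
    rw [orderOf_eq_card_of_forall_mem_zpowers hφ,
      MulChar.card_eq_card_units_of_hasEnoughRootsOfUnity, Nat.card_units,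
      Nat.card_eq_fintype_card]
  have hq : Fintype.card k - 1 ≠ 0 := (Nat.sub_pos_of_lt Fintype.one_lt_card).ne'
  rw [phiD, ← h]
  exact orderOf_pow_orderOf_div (h ▸ hq) (h ▸ hd)

lemma phiD_zpow_eq_one_iff (hd : d ∣ Fintype.card k - 1) {φ : MulChar k K}
    (hφ : ∀ η : MulChar k K, η ∈ Subgroup.zpowers φ) {n : ℤ} :
    phiD d φ ^ n = 1 ↔ (d : ℤ) ∣ n := by
  rw [← orderOf_dvd_iff_zpow_eq_one, orderOf_phiD hd hφ]

variable (K) in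
lemma natCast_ne_zero_of_dvd_card_sub_one (hd : d ∣ Fintype.card k - 1) : (d : K) ≠ 0 :=
  ne_zero_of_dvd_ne_zero (natCast_card_sub_one_ne_zero k K) (Nat.cast_dvd_cast hd)

end Generator

section Surface

lemma mulChar_zpow_apply_pow {k K : Type*} [Field k] [Field K] {d : ℕ} {χ : MulChar k K}
    (hχ : χ ^ d = 1) (m : ℤ) {n : ℤ} {e : ℕ} (he : e ≠ 0) (hen : (d : ℤ) ∣ e - n) (z : k) :
    (χ ^ m) (z ^ e) = (χ ^ (m * n)) z := by
  obtain ⟨t, ht⟩ := hen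
  have h : χ ^ (m * e) = χ ^ (m * n) := by
    rw [← sub_add_cancel (e : ℤ) n, ht, mul_add, zpow_add, mul_left_comm, zpow_mul, zpow_natCast,
      hχ, one_zpow, one_mul]
  rw [map_pow, ← MulChar.pow_apply' _ he, ← zpow_natCast, ← zpow_mul, h]

lemma mulChar_zpow_eval_poly4 {k K : Type*} [Field k] [Field K] {d : ℕ} {χ : MulChar k K}
    (hχ : χ ^ d = 1) (m : ℤ) {a b c₁ c₂ : ℤ} {e : ℤ → ℕ} (he : ∀ n, (d : ℤ) ∣ e n - n)
    (h₁ : e a ≠ 0) (h₂ : e b ≠ 0) (h₃ : e (c₁ - a) ≠ 0) (h₄ : e (c₂ - b) ≠ 0)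
    (h₅ : e (a - c₁ - c₂) ≠ 0) (h₆ : e (b - c₁ - c₂) ≠ 0) (h₇ : e (c₁ + c₂ - a - b) ≠ 0)
    (l₁ l₂ : k) (x : Fin 2 → k) :
    (χ ^ m) (MvPolynomial.eval x (poly4 e a b c₁ c₂ l₁ l₂)) =
      surfaceTerm (χ ^ (m * a)) (χ ^ (m * b)) (χ ^ (m * (c₁ - a))) (χ ^ (m * (c₂ - b))) l₁ l₂
        (x 0) (x 1) := by
  have f₅ : (χ ^ (m * b) * χ ^ (m * (c₁ - a)) * χ ^ (m * (c₂ - b)))⁻¹ =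
      χ ^ (m * (a - c₁ - c₂)) := by
    rw [← zpow_add, ← zpow_add, ← zpow_neg]; ring_nf
  have f₆ : (χ ^ (m * a) * χ ^ (m * (c₁ - a)) * χ ^ (m * (c₂ - b)))⁻¹ =
      χ ^ (m * (b - c₁ - c₂)) := by
    rw [← zpow_add, ← zpow_add, ← zpow_neg]; ring_nf
  have f₇ : χ ^ (m * (c₁ - a)) * χ ^ (m * (c₂ - b)) = χ ^ (m * (c₁ + c₂ - a - b)) := by
    rw [← zpow_add]; ring_nf
  rw [surfaceTerm, f₅, f₆, f₇, poly4]
  simp only [map_mul (MvPolynomial.eval x), map_pow (MvPolynomial.eval x), map_sub, map_one,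
    MvPolynomial.eval_X, MvPolynomial.eval_C, map_mul (χ ^ m)]
  rw [mulChar_zpow_apply_pow hχ m h₁ (he _), mulChar_zpow_apply_pow hχ m h₂ (he _),
    mulChar_zpow_apply_pow hχ m h₃ (he _), mulChar_zpow_apply_pow hχ m h₄ (he _),
    mulChar_zpow_apply_pow hχ m h₅ (he _), mulChar_zpow_apply_pow hχ m h₆ (he _),
    mulChar_zpow_apply_pow hχ m h₇ (he _)]

lemma N_poly4_eq_rhs4 {k K : Type*} [Field k] [Fintype k] [Field K]
    [HasEnoughRootsOfUnity K (Monoid.exponent kˣ)] {ψ : AddChar k K} (hψ : ψ ≠ 1)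
    {φ : MulChar k K} (hφ : ∀ η : MulChar k K, η ∈ Subgroup.zpowers φ) {d : ℕ}
    (hd : d ∣ Fintype.card k - 1) {a b c₁ c₂ : ℤ} {l₁ l₂ : k} (hl₁ : l₁ ≠ 0) (hl₂ : l₂ ≠ 0)
    (hl₁' : l₁ ≠ 1) (hl₂' : l₂ ≠ 1) {m : ℤ} (ha : ¬ (d : ℤ) ∣ m * a) (hb : ¬ (d : ℤ) ∣ m * b)
    (hca : ¬ (d : ℤ) ∣ m * (c₁ - a)) (hcb : ¬ (d : ℤ) ∣ m * (c₂ - b)) {e : ℤ → ℕ}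
    (he : ∀ n, (d : ℤ) ∣ e n - n) (h₁ : e a ≠ 0) (h₂ : e b ≠ 0) (h₃ : e (c₁ - a) ≠ 0)
    (h₄ : e (c₂ - b) ≠ 0) (h₅ : e (a - c₁ - c₂) ≠ 0) (h₆ : e (b - c₁ - c₂) ≠ 0)
    (h₇ : e (c₁ + c₂ - a - b) ≠ 0) :
    N (CyclicSurface d (poly4 e a b c₁ c₂ l₁ l₂)) CyclicSurface.frob (chi d φ ^ m) 1 =
      rhs4 ψ (phiD d φ ^ (m * a)) (phiD d φ ^ (m * b)) (phiD d φ ^ (m * c₁))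
        (phiD d φ ^ (m * c₂)) l₁ l₂ := by
  have ne {n : ℤ} (hn : ¬ (d : ℤ) ∣ n) : phiD d φ ^ n ≠ 1 := (phiD_zpow_eq_one_iff hd hφ).not.2 hn
  have hχ : phiD d φ ^ d = 1 := orderOf_dvd_iff_pow_eq_one.1 (orderOf_phiD hd hφ).dvd
  have hγ (s t : ℤ) : phiD d φ ^ (m * t) = phiD d φ ^ (m * s) * phiD d φ ^ (m * (t - s)) := by
    rw [← zpow_add, ← mul_add, add_sub_cancel]
  rw [N_cyclicSurface_chi_eq_sum hd (natCast_ne_zero_of_dvd_card_sub_one K hd) _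
      (ne fun h => ha (h.mul_right a)), hγ a c₁, hγ b c₂,
    ← sum_surfaceTerm_eq_rhs4 hψ (ne ha) (ne hb) (ne hca) (ne hcb) hl₁ hl₁' hl₂ hl₂',
    ← Fintype.sum_prod_type']
  exact Fintype.sum_equiv (finTwoArrowEquiv k) _ _
    (mulChar_zpow_eval_poly4 hχ m he h₁ h₂ h₃ h₄ h₅ h₆ h₇ l₁ l₂)

end Surface

section Residues

variable {d : ℕ}

lemma dvd_res_sub (hd : d ≠ 0) (n : ℤ) : (d : ℤ) ∣ res d n - n := by
  rw [res, Int.toNat_of_nonneg (Int.emod_nonneg n (Nat.cast_ne_zero.2 hd))]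
  exact Int.dvd_emod_sub_self

lemma res_ne_zero (hd : d ≠ 0) {n : ℤ} (hn : ¬ (d : ℤ) ∣ n) : res d n ≠ 0 := by
  intro h
  simpa [h, hn] using dvd_res_sub hd n

lemma dvd_posRes_sub (hd : d ≠ 0) (n : ℤ) : (d : ℤ) ∣ posRes d n - n := by
  rw [posRes]
  split_ifs with h
  · exact dvd_sub_self_left.2 h
  · exact dvd_res_sub hd n

lemma posRes_ne_zero (hd : d ≠ 0) (n : ℤ) : posRes d n ≠ 0 := by
  rw [posRes]
  split_ifs with h
  · exact hd
  · exact res_ne_zero hd h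

end Residues

end AppellFF

open AppellFF in
theorem theoremN_general {k K : Type*} [Field k] [Fintype k] [Field K]
    [HasEnoughRootsOfUnity K (Monoid.exponent kˣ)] (ψ : AddChar k K) (hψ : ψ ≠ 1)
    (φ : MulChar k K) (hφ : ∀ η : MulChar k K, η ∈ Subgroup.zpowers φ) (d : ℕ)
    (hd : d ∣ Fintype.card k - 1) (a b c₁ c₂ : ℤ) (l₁ l₂ : k) (hl₁ : l₁ ≠ 0) (hl₂ : l₂ ≠ 0)
    (hl₁' : l₁ ≠ 1) (hl₂' : l₂ ≠ 1) (m : ℤ) :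
    ((d : ℤ) ∣ m →
      N (Surface4 d a b c₁ c₂ l₁ l₂) CyclicSurface.frob (chi d φ ^ m) 1 =
        (Fintype.card k : K) ^ 2) ∧
    (¬ (d : ℤ) ∣ m * a → ¬ (d : ℤ) ∣ m * b → ¬ (d : ℤ) ∣ m * (c₁ - a) →
      ¬ (d : ℤ) ∣ m * (c₂ - b) →
      ¬ (d : ℤ) ∣ a - c₁ - c₂ → ¬ (d : ℤ) ∣ b - c₁ - c₂ → ¬ (d : ℤ) ∣ c₁ + c₂ - a - b →
      N (Surface4 d a b c₁ c₂ l₁ l₂) CyclicSurface.frob (chi d φ ^ m) 1 =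
        rhs4 ψ (phiD d φ ^ (m * a)) (phiD d φ ^ (m * b)) (phiD d φ ^ (m * c₁))
          (phiD d φ ^ (m * c₂)) l₁ l₂) ∧
    ((d : ℤ) ∣ m →
      N (Surface4Pos d a b c₁ c₂ l₁ l₂) CyclicSurface.frob (chi d φ ^ m) 1 =
        (Fintype.card k : K) ^ 2) ∧
    (¬ (d : ℤ) ∣ m * a → ¬ (d : ℤ) ∣ m * b → ¬ (d : ℤ) ∣ m * (c₁ - a) →
      ¬ (d : ℤ) ∣ m * (c₂ - b) →
      N (Surface4Pos d a b c₁ c₂ l₁ l₂) CyclicSurface.frob (chi d φ ^ m) 1 =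
        rhs4 ψ (phiD d φ ^ (m * a)) (phiD d φ ^ (m * b)) (phiD d φ ^ (m * c₁))
          (phiD d φ ^ (m * c₂)) l₁ l₂) := by
  have hd0 := (pos_of_dvd_card_sub_one hd).ne'
  have hdK := natCast_ne_zero_of_dvd_card_sub_one K hd
  have trivial_char {f : MvPolynomial (Fin 2) k} (hm : (d : ℤ) ∣ m) :
      N (CyclicSurface d f) CyclicSurface.frob (chi d φ ^ m) 1 = (Fintype.card k : K) ^ 2 := by
    rw [chi_zpow_eq_one hm, N_cyclicSurface_one hd hdK]
  refine ⟨trivial_char, fun ha hb hca hcb h₅ h₆ h₇ => ?_, trivial_char, fun ha hb hca hcb => ?_⟩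
  · have res_ne {n : ℤ} (hn : ¬ (d : ℤ) ∣ m * n) : res d n ≠ 0 :=
      res_ne_zero hd0 fun h => hn (h.mul_left m)
    exact N_poly4_eq_rhs4 hψ hφ hd hl₁ hl₂ hl₁' hl₂' ha hb hca hcb (dvd_res_sub hd0) (res_ne ha)
      (res_ne hb) (res_ne hca) (res_ne hcb) (res_ne_zero hd0 h₅) (res_ne_zero hd0 h₆)
      (res_ne_zero hd0 h₇)
  · have posRes_ne := posRes_ne_zero hd0
    exact N_poly4_eq_rhs4 hψ hφ hd hl₁ hl₂ hl₁' hl₂' ha hb hca hcb (dvd_posRes_sub hd0)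
      (posRes_ne _) (posRes_ne _) (posRes_ne _) (posRes_ne _) (posRes_ne _) (posRes_ne _)
      (posRes_ne _)

theorem theoremN {k K : Type*} [Field k] [Fintype k] [Field K] [CharZero K] [IsAlgClosed K]
    (ψ : AddChar k K) (hψ : ψ ≠ 1)
    (φ : MulChar k K) (hφ : ∀ η : MulChar k K, η ∈ Subgroup.zpowers φ)
    (d : ℕ) (hd : d ∣ Fintype.card k - 1)
    (a b c₁ c₂ : ℤ)
    (ha : Int.gcd d a = 1) (hb : Int.gcd d b = 1)
    (hc₁a : Int.gcd d (c₁ - a) = 1) (hc₂a : Int.gcd d (c₂ - a) = 1)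
    (hc₁b : Int.gcd d (c₁ - b) = 1) (hc₂b : Int.gcd d (c₂ - b) = 1)
    (l₁ l₂ : k) (hl₁ : l₁ ≠ 0) (hl₂ : l₂ ≠ 0) (hl₁' : l₁ ≠ 1) (hl₂' : l₂ ≠ 1)
    (m : ℤ) :
    -- the surface with exponents in `{0, …, d - 1}`
    ((d : ℤ) ∣ m →
      AppellFF.N (AppellFF.Surface4 d a b c₁ c₂ l₁ l₂) AppellFF.CyclicSurface.frob
        (AppellFF.chi d φ ^ m) 1 = (Fintype.card k : K) ^ 2) ∧
    (¬ (d : ℤ) ∣ m →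
      ¬ (d : ℤ) ∣ a - c₁ - c₂ → ¬ (d : ℤ) ∣ b - c₁ - c₂ → ¬ (d : ℤ) ∣ c₁ + c₂ - a - b →
      AppellFF.N (AppellFF.Surface4 d a b c₁ c₂ l₁ l₂) AppellFF.CyclicSurface.frob
        (AppellFF.chi d φ ^ m) 1 =
      AppellFF.rhs4 ψ (AppellFF.phiD d φ ^ (m * a)) (AppellFF.phiD d φ ^ (m * b))
        (AppellFF.phiD d φ ^ (m * c₁)) (AppellFF.phiD d φ ^ (m * c₂)) l₁ l₂) ∧
    -- the surface with exponents in `{1, …, d}`, where nothing has to be excluded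
    ((d : ℤ) ∣ m →
      AppellFF.N (AppellFF.Surface4Pos d a b c₁ c₂ l₁ l₂) AppellFF.CyclicSurface.frob
        (AppellFF.chi d φ ^ m) 1 = (Fintype.card k : K) ^ 2) ∧
    (¬ (d : ℤ) ∣ m →
      AppellFF.N (AppellFF.Surface4Pos d a b c₁ c₂ l₁ l₂) AppellFF.CyclicSurface.frob
        (AppellFF.chi d φ ^ m) 1 =
      AppellFF.rhs4 ψ (AppellFF.phiD d φ ^ (m * a)) (AppellFF.phiD d φ ^ (m * b))
        (AppellFF.phiD d φ ^ (m * c₁)) (AppellFF.phiD d φ ^ (m * c₂)) l₁ l₂) := by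
  have not_dvd {n : ℤ} (hn : Int.gcd d n = 1) (hm : ¬ (d : ℤ) ∣ m) : ¬ (d : ℤ) ∣ m * n :=
    fun h => hm (Int.dvd_of_dvd_mul_left_of_gcd_one h hn)
  obtain ⟨h₁, h₂, h₃, h₄⟩ :=
    theoremN_general ψ hψ φ hφ d hd a b c₁ c₂ l₁ l₂ hl₁ hl₂ hl₁' hl₂' m
  exact ⟨h₁, fun hm => h₂ (not_dvd ha hm) (not_dvd hb hm) (not_dvd hc₁a hm) (not_dvd hc₂b hm),
    h₃, fun hm => h₄ (not_dvd ha hm) (not_dvd hb hm) (not_dvd hc₁a hm) (not_dvd hc₂b hm)⟩
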